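/- **Setting.** Let $M\ge 2$ and $N\ge 1$, and let $\mathcal A$ be a finite abelian group with $|\mathcal A|\ge 2$. Files $W_1,\dots,W_M\in\mathcal A^{L}$, $L=N^M$, are independent and uniform, and all of them are stored on each of $N$ non-colluding servers. A client wants $W_\theta$, with $\theta$ uniform on $\{1,\dots,M\}$. It sends to each server $l$ a query $Q_l^\theta$, which depends on $\theta$ and on private randomness (independent of the files). Server $l$ returns a string $A_l^\theta$ of symbols of $\mathcal A$ that is a deterministic function of its query and the files; a string of $n$ symbols has length $\ell=n\log|\mathcal A|$ bits. Logarithms are to base 2. The rate and the mutual-information leakage of such a scheme are $$R=\frac{L\log|\mathcal A|}{\mathbb E\left[\sum_l \ell(A_l^\theta)\right]},\qquad \rho^{\mathsf{MIL}}=\frac1N\sum_{l} I(\theta;Q_l^\theta).$$ **Sun–Jafar queries.** Consider a set $T$ of $s\ge 2$ files that contains the desired file $k$, each file being cut, in order, into $N^s$ super-segments of $N^{M-s}$ symbols. The super-segments of each file of $T$ are put in a uniformly random order, independently for different files; "new" means the next unused one. For every nonempty $V\subseteq T$, say with $b$ elements, each server is asked for $(N-1)^{b-1}$ sums (componentwise,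 in $\mathcal A^{N^{M-s}}$) that contain one super-segment of each file in $V$. If $k\notin V$, all super-segments in such a sum are new. If $V=\{k\}$, the server is asked for one new super-segment of file $k$. If $k\in V\neq\{k\}$, the sums asked from server $l$ are obtained by adding one new super-segment of file $k$ to each of the sums of type $V\setminus\{k\}$ that are asked from the other servers $l'\ne l$. The query to a server consists of the set $T$ and of the (unordered) set of the sums asked from it, and the server answers with their values. **The scheme $\mathcal P_{\mathsf{WSJ}}$.** It has a parameter, the distribution $\mathsf P_{M'}$ of a random variable $M'$ on $\{0,\dots,M-1\}$. For desired file $k$, the client draws $M'$. If $M'=0$, it requests the whole file $W_k$ from a uniformly random server and sends a null query, which gets an empty answer, to all others. If $M'=m'\ne0$, it draws a uniformly random set $J$ of $m'$ other files and executes the Sun–Jafar queries on $T=J\cup\{k\}$. **Theorem.** For every real $\rho\ge0$ there is a distribution $\mathsf P_{M'}$ on $\{0,\dots,M-1\}$ for which $\mathcal P_{\mathsf{WSJ}}$ is correct, i.e. $H(W_k\mid A^{k}_{1},\dots,A^k_N,Q^{k}_{1},\dots,Q^k_N)=0$ for every desired index $k$, and, if $N\ge2$, even $H(W_\theta\mid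 A^{\theta}_{1},\dots,A^\theta_N,Q^{\theta}_{1},\dots,Q^\theta_N)=0$ for random $\theta$, and which satisfies $$\rho^{\mathsf{MIL}}=\min\left(\rho,\frac{\log M}{N}\right),\qquad R=\left(1+\left(1-\frac{\rho N}{\log M}\right)_+\left(\frac1N+\cdots+\frac1{N^{M-1}}\right)\right)^{-1},$$ where $(x)_+=\max(x,0)$. -/

import Mathlib

noncomputable section

/-! ## Entropy and mutual information (in bits) of finitely valued random variables -/

/-- `I(X; Y)`, where `p` is the joint law of `(X, Y)`. -/
def mutualInfo {α β : Type*} (p : PMF (α × β)) : ℝ :=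
  ∑' x : α × β, (p x).toReal *
    Real.logb 2 ((p x).toReal / ((p.map Prod.fst x.1).toReal * (p.map Prod.snd x.2).toReal))

/-- `H(X | Y)`, where `p` is the joint law of `(X, Y)`. -/
def condEntropy {α β : Type*} (p : PMF (α × β)) : ℝ :=
  -∑' x : α × β, (p x).toReal * Real.logb 2 ((p x).toReal / (p.map Prod.snd x.2).toReal)

/-! ## Information retrieval schemes -/

/-- An information retrieval scheme for `M` files replicated on `N` servers. A file is a string of
`L` symbols of `A`; the desired index is uniform, and so are the files.
`queryLaw k` is the law of the tuple of queries when file `k` is desired. A server answers with a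
string of symbols of `A`, whose positions are indexed by a finite type that depends on the query;
the string is a deterministic function of the query and the stored files. -/
structure IRScheme (M N : ℕ) (A : Type*) where
  L : ℕ
  Query : Type
  finiteQuery : Finite Query
  queryLaw : Fin M → PMF (Fin N → Query)
  AnswerPos : Query → Type
  fintypeAnswerPos : ∀ q, Fintype (AnswerPos q)
  answer : Fin N → (q : Query) → (Fin M → Fin L → A) → AnswerPos q → A

namespace IRScheme

variable {M N : ℕ} {A : Type*}

/-- The joint law of the desired index `θ` (uniform) and the queries. -/
def indexQueryLaw [NeZero M] (C : IRScheme M N A) : PMF (Fin M × (Fin N → C.Query)) :=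
  (PMF.uniformOfFintype (Fin M)).bind fun k => (C.queryLaw k).map fun Q => (k, Q)

/-- The joint law of the desired file and of all queries and answers, given that the desired
index is `k`. -/
def retrievalLaw [Fintype A] [Nonempty A] (C : IRScheme M N A) (k : Fin M) :
    PMF ((Fin C.L → A) × (Fin N → (q : C.Query) × (C.AnswerPos q → A))) :=
  (C.queryLaw k).bind fun Q =>
    (PMF.uniformOfFintype (Fin M → Fin C.L → A)).map fun W =>
      (W k, fun l => ⟨Q l, C.answer l (Q l) W⟩)

/-- `H(W_θ | A^θ, Q^θ) = 0` for the random index `θ`. -/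
def Correct [NeZero M] [Fintype A] [Nonempty A] (C : IRScheme M N A) : Prop :=
  condEntropy ((PMF.uniformOfFintype (Fin M)).bind C.retrievalLaw) = 0

/-- `H(W_k | A^k, Q^k) = 0` for every value `k` of the desired index, which the client knows. -/
def CorrectForEachIndex [Fintype A] [Nonempty A] (C : IRScheme M N A) : Prop :=
  ∀ k : Fin M, condEntropy (C.retrievalLaw k) = 0

/-- The number of downloaded bits, as a function of the queries. -/
def downloadBits [Fintype A] (C : IRScheme M N A) (Q : Fin N → C.Query) : ℝ :=
  ∑ l, (@Fintype.card (C.AnswerPos (Q l)) (C.fintypeAnswerPos (Q l)) : ℝ) *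
    Real.logb 2 (Fintype.card A)

/-- The rate: the file size in bits over the expected number of downloaded bits. -/
def rate [NeZero M] [Fintype A] (C : IRScheme M N A) : ℝ :=
  (C.L * Real.logb 2 (Fintype.card A)) /
    ∑' x : Fin M × (Fin N → C.Query), (C.indexQueryLaw x).toReal * C.downloadBits x.2

/-- The mutual information leakage: the average of `I(θ; Q_l)` over the servers `l`. -/
def mutualInfoLeakage [NeZero M] (C : IRScheme M N A) : ℝ :=
  (1 / (N : ℝ)) * ∑ l : Fin N, mutualInfo (C.indexQueryLaw.map fun x => (x.1, x.2 l))

end IRScheme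

/-! ## The Sun–Jafar query generation

The files are indexed by a finite type `ι` with `s` elements, and each consists of `N ^ s`
(super-)segments. For every nonempty set `V` of `b` files, every server is asked for
`(N - 1) ^ (b - 1)` sums of one segment from each file of `V`. The sums of type `V` at
server `l` are indexed by the words `l = l₁, l₂, …, l_b` of servers with `lᵢ ≠ lᵢ₊₁`.
If the desired file `k` is not in `V`, all segments in such a sum are new. If it is, the sum
consists of a new segment of file `k` and, as side information, of the sum of type `V \ {k}` with
index `l₂, …, l_b`, which is downloaded from the server `l₂ ≠ l`. -/

/-- A sum to be downloaded: the set of files involved, and its index, a word of servers whose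
first letter is the server that is asked for the sum. -/
structure SJSlot (N : ℕ) (ι : Type) where
  files : Finset ι
  word : List (Fin N)
  nonempty : files.Nonempty
  length_eq : word.length = files.card
  chain : word.IsChain (· ≠ ·)

/-- The sums that involve file `j`. They name the segments of file `j`: the segment `x` of
file `j` is the one that enters the sum `x` as a new segment (if there is any). -/
abbrev SJLabel (N : ℕ) {ι : Type} (j : ι) : Type := {x : SJSlot N ι // j ∈ x.files}

/-- A query: a set of sums, each given as the set of the pairs (file, segment) in it. -/
abbrev SJQuery (N : ℕ) (ι : Type) [Fintype ι] : Type :=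
  Finset (Finset (ι × Fin (N ^ Fintype.card ι)))

section SunJafar

variable {N : ℕ} {ι : Type}

instance SJSlot.instFinite [Finite ι] : Finite (SJSlot N ι) := by
  have := Fintype.ofFinite ι
  have h : Finite {w : List (Fin N) // w.length ≤ Fintype.card ι} :=
    (List.finite_length_le (Fin N) (Fintype.card ι)).to_subtype
  refine Finite.of_injective
    (fun x : SJSlot N ι => ((x.files,
      ⟨x.word, by rw [x.length_eq]; exact Finset.card_le_univ _⟩) :
      Finset ι × {w : List (Fin N) // w.length ≤ Fintype.card ι})) ?_
  rintro ⟨V, w, _, _, _⟩ ⟨V', w', _, _, _⟩ h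
  simp only [Prod.mk.injEq, Subtype.mk.injEq] at h
  obtain ⟨rfl, rfl⟩ := h
  rfl

instance SJSlot.instFintype [Finite ι] : Fintype (SJSlot N ι) := Fintype.ofFinite _

instance SJSlot.instDecidableEq : DecidableEq (SJSlot N ι) := Classical.decEq _

instance SJLabel.instFintype [Finite ι] (j : ι) : Fintype (SJLabel N j) := Fintype.ofFinite _

/-- The segment of file `j` (for `j` in `x.files`) that enters the sum `x` when file `k` is
desired. -/
def SJSlot.label [DecidableEq ι] (k : ι) (x : SJSlot N ι) (j : ι) (hj : j ∈ x.files) :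
    SJLabel N j :=
  if h : k ∈ x.files ∧ j ≠ k then
    ⟨{ files := x.files.erase k
       word := x.word.tail
       nonempty := ⟨j, Finset.mem_erase.2 ⟨h.2, hj⟩⟩
       length_eq := by rw [List.length_tail, x.length_eq, Finset.card_erase_of_mem h.1]
       chain := x.chain.tail }, Finset.mem_erase.2 ⟨h.2, hj⟩⟩
  else ⟨x, hj⟩

end SunJafar

theorem SJLabel.card_words (N n : ℕ) (l : Fin N) :
    Nat.card {w : List (Fin N) // w.length = n ∧ (l :: w).IsChain (· ≠ ·)} = (N - 1) ^ n := by
  induction n generalizing l with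
  | zero =>
    rw [pow_zero, Nat.card_eq_one_iff_unique]
    refine ⟨⟨?_⟩, ⟨⟨[], by simp⟩⟩⟩
    rintro ⟨a, ha, _⟩ ⟨b, hb, _⟩
    rw [List.length_eq_zero_iff] at ha hb
    subst ha hb
    rfl
  | succ n ih =>
    have e : {w : List (Fin N) // w.length = n + 1 ∧ (l :: w).IsChain (· ≠ ·)} ≃
        ((m : {m : Fin N // l ≠ m}) ×
          {w : List (Fin N) // w.length = n ∧ (m.1 :: w).IsChain (· ≠ ·)}) :=
      { toFun := fun x => match x with
          | ⟨[], h⟩ => absurd h.1 (by simp)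
          | ⟨m :: w, h⟩ => ⟨⟨m, (List.isChain_cons_cons.1 h.2).1⟩,
              ⟨w, by simpa using h.1, (List.isChain_cons_cons.1 h.2).2⟩⟩
        invFun := fun x => ⟨x.1.1 :: x.2.1, by simp [x.2.2.1],
          List.isChain_cons_cons.2 ⟨x.1.2, x.2.2.2⟩⟩
        left_inv := by
          rintro ⟨_ | ⟨m, w⟩, h⟩
          · exact absurd h.1 (by simp)
          · rfl
        right_inv := fun x => rfl }
    have hfin : ∀ m : {m : Fin N // l ≠ m},
        Finite {w : List (Fin N) // w.length = n ∧ (m.1 :: w).IsChain (· ≠ ·)} := fun m =>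
      ((List.finite_length_eq (Fin N) n).subset (fun w h => h.1)).to_subtype
    rw [Nat.card_congr e, Nat.card_sigma]
    simp only [ih, Finset.sum_const, smul_eq_mul, Finset.card_univ]
    rw [pow_succ', Fintype.card_subtype_compl (fun m => l = m) ]
    simp
theorem SJLabel.card_eq (N : ℕ) [NeZero N] {ι : Type} [Fintype ι] (j : ι) :
    Fintype.card (SJLabel N j) = N ^ Fintype.card ι := by
  classical
  have e : SJLabel N j ≃ ((y : {V : Finset ι // j ∈ V} × Fin N) ×
      {w : List (Fin N) // w.length = y.1.1.card - 1 ∧ (y.2 :: w).IsChain (· ≠ ·)}) :=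
    { toFun := fun x => match x with
        | ⟨⟨V, [], h, h', _⟩, _⟩ => absurd h' (by simpa using h.card_pos.ne)
        | ⟨⟨V, l :: w, _, h', c⟩, hj⟩ => ⟨(⟨V, hj⟩, l), ⟨w, by simp [← h'], c⟩⟩
      invFun := fun x => ⟨⟨x.1.1.1, x.1.2 :: x.2.1, ⟨j, x.1.1.2⟩, by
        rw [List.length_cons, x.2.2.1]
        exact Nat.sub_add_cancel (Finset.card_pos.2 ⟨j, x.1.1.2⟩), x.2.2.2⟩, x.1.1.2⟩
      left_inv := by
        rintro ⟨⟨V, _ | ⟨l, w⟩, h, h', c⟩, hj⟩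
        · exact absurd h' (by simpa using h.card_pos.ne)
        · rfl
      right_inv := fun x => rfl }
  have hfin : ∀ y : {V : Finset ι // j ∈ V} × Fin N,
      Finite {w : List (Fin N) // w.length = y.1.1.card - 1 ∧ (y.2 :: w).IsChain (· ≠ ·)} :=
    fun y => ((List.finite_length_eq (Fin N) _).subset (fun w h => h.1)).to_subtype
  rw [← Nat.card_eq_fintype_card, Nat.card_congr e, Nat.card_sigma]
  simp only [SJLabel.card_words]
  rw [Fintype.sum_prod_type]
  simp only [Finset.sum_const, Finset.card_univ, Fintype.card_fin, smul_eq_mul]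
  rw [← Finset.mul_sum]
  have h1 : ∑ V : {V : Finset ι // j ∈ V}, (N - 1) ^ (V.1.card - 1) =
      ∑ U ∈ (Finset.univ.erase j).powerset, (N - 1) ^ U.card := by
    refine Finset.sum_bij' (fun V _ => V.1.erase j)
      (fun U _ => ⟨insert j U, Finset.mem_insert_self j U⟩) ?_ ?_ ?_ ?_ ?_
    · intro V _
      exact Finset.mem_powerset.2 (Finset.erase_subset_erase j (Finset.subset_univ _))
    · intro U _
      exact Finset.mem_univ _
    · intro V _
      exact Subtype.ext (Finset.insert_erase V.2)
    · intro U hU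
      refine Finset.erase_insert fun h => ?_
      exact Finset.notMem_erase j _ (Finset.mem_powerset.1 hU h)
    · intro V _
      rw [Finset.card_erase_of_mem V.2]
  have h2 := Finset.sum_pow_mul_eq_add_pow (N - 1) 1 (Finset.univ.erase j)
  simp only [one_pow, mul_one] at h2
  rw [h1, h2, Finset.card_erase_of_mem (Finset.mem_univ j),
    Nat.sub_add_cancel (Nat.one_le_iff_ne_zero.2 (NeZero.ne N)), Finset.card_univ, ← pow_succ',
    Nat.sub_add_cancel (Fintype.card_pos_iff.2 ⟨j⟩)]

section SunJafar

variable {N : ℕ} {ι : Type} [Fintype ι] [DecidableEq ι]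

instance SJLabel.instNonemptyEquiv [NeZero N] :
    Nonempty ((j : ι) → SJLabel N j ≃ Fin (N ^ Fintype.card ι)) :=
  ⟨fun j => Fintype.equivFinOfCardEq (SJLabel.card_eq N j)⟩

/-- The sum `x`, when file `k` is desired and `σ j` is the order in which the segments of file `j`
are used. -/
def sjSum (k : ι) (σ : (j : ι) → SJLabel N j ≃ Fin (N ^ Fintype.card ι)) (x : SJSlot N ι) :
    Finset (ι × Fin (N ^ Fintype.card ι)) :=
  x.files.attach.image fun j => (j.1, σ j.1 (x.label k j.1 j.2))

/-- The query to server `l`. -/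
def sjQuery (k : ι) (σ : (j : ι) → SJLabel N j ≃ Fin (N ^ Fintype.card ι)) (l : Fin N) :
    SJQuery N ι :=
  (Finset.univ.filter fun x : SJSlot N ι => x.word.head? = some l).image (sjSum k σ)

/-- The law of the queries when file `k` is desired: the segments of each file are used in a
uniformly random order, independently for different files. -/
def sjQueryLaw (N : ℕ) [NeZero N] (k : ι) : PMF (Fin N → SJQuery N ι) :=
  (PMF.uniformOfFintype ((j : ι) → SJLabel N j ≃ Fin (N ^ Fintype.card ι))).map (sjQuery k)

end SunJafar

/-! ## The weakly private scheme -/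

/-- The queries: the null query, the query for the whole file `k`, and the Sun–Jafar queries
on a set `T` of files. -/
inductive WSJQuery (M N : ℕ) : Type
  | null : WSJQuery M N
  | clean (k : Fin M) : WSJQuery M N
  | sj (T : Finset (Fin M)) (q : SJQuery N T) : WSJQuery M N

namespace WSJ

variable {M N : ℕ}

theorem finite_query (M N : ℕ) : Finite (WSJQuery M N) := by
  refine Finite.of_surjective
    (fun x : Option (Fin M ⊕ ((T : Finset (Fin M)) × SJQuery N T)) => match x with
      | none => WSJQuery.null
      | some (Sum.inl k) => WSJQuery.clean k
      | some (Sum.inr y) => WSJQuery.sj y.1 y.2) ?_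
  rintro (_ | k | ⟨T, q⟩)
  · exact ⟨none, rfl⟩
  · exact ⟨some (Sum.inl k), rfl⟩
  · exact ⟨some (Sum.inr ⟨T, q⟩), rfl⟩

theorem powersetCard_nonempty (k m : Fin M) :
    (Finset.powersetCard m.1 (Finset.univ.erase k)).Nonempty := by
  rw [Finset.powersetCard_nonempty, Finset.card_erase_of_mem (Finset.mem_univ k),
    Finset.card_univ, Fintype.card_fin]
  omega

/-- Query generation for the desired file `k`. The number `M'` of additional files has law `P`.
If `M' = 0`, file `k` is requested from a uniformly random server and the others receive the null
query. Otherwise the Sun–Jafar queries are made for file `k` among file `k` and a uniformly random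
set `J` of `M'` other files. -/
def queryLaw [NeZero N] (P : PMF (Fin M)) (k : Fin M) : PMF (Fin N → WSJQuery M N) :=
  P.bind fun m =>
    if m.1 = 0 then
      (PMF.uniformOfFintype (Fin N)).map fun S l => if l = S then .clean k else .null
    else
      (PMF.uniformOfFinset _ (powersetCard_nonempty k m)).bind fun J =>
        (sjQueryLaw (ι := (insert k J : Finset (Fin M))) N ⟨k, Finset.mem_insert_self k J⟩).map
          fun q l => .sj (insert k J) (q l)

/-- The `r`-th symbol in the `a`-th super-segment of a file of `N ^ M` symbols that is cut in order
into `N ^ s` super-segments of `N ^ (M - s)` symbols, where `s` is the number of files in `T`. -/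
def symbolIndex (T : Finset (Fin M)) (a : Fin (N ^ Fintype.card T))
    (r : Fin (N ^ (M - Fintype.card T))) : Fin (N ^ M) :=
  Fin.cast (by
    rw [← pow_add, Nat.add_sub_cancel']
    simpa using Finset.card_le_univ T) (finProdFinEquiv (a, r))

/-- The positions in the answer to a query: none for the null query, those of a file for a
clean download, and those of one super-segment per requested sum otherwise. -/
abbrev AnswerPos : WSJQuery M N → Type
  | .null => Empty
  | .clean _ => Fin (N ^ M)
  | .sj T q => q × Fin (N ^ (M - Fintype.card T))

instance instFintypeAnswerPos : (q : WSJQuery M N) → Fintype (AnswerPos q)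
  | .null => inferInstanceAs (Fintype Empty)
  | .clean _ => inferInstanceAs (Fintype (Fin (N ^ M)))
  | .sj T q => inferInstanceAs (Fintype (q × Fin (N ^ (M - Fintype.card T))))

/-- The answer to a query. -/
def answer {A : Type*} [AddCommGroup A] :
    (q : WSJQuery M N) → (Fin M → Fin (N ^ M) → A) → AnswerPos q → A
  | .null, _ => fun e => e.elim
  | .clean k, W => W k
  | .sj T _, W => fun p => ∑ y ∈ p.1.1, W y.1 (symbolIndex T y.2 p.2)

end WSJ

/-- The scheme in which the number `M'` of additional files has law `P`. -/
def wsjScheme {M N : ℕ} [NeZero N] (A : Type*) [AddCommGroup A] (P : PMF (Fin M)) :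
    IRScheme M N A where
  L := N ^ M
  Query := WSJQuery M N
  finiteQuery := WSJ.finite_query M N
  queryLaw := WSJ.queryLaw P
  AnswerPos := WSJ.AnswerPos
  fintypeAnswerPos := WSJ.instFintypeAnswerPos
  answer := fun _ => WSJ.answer

end

noncomputable section

open Finset

/-! ## Combinatorics of the Sun–Jafar sums -/

section SunJafarCombinatorics

variable {N : ℕ} {ι : Type}

/-! The scheme mixes its two extremes: $M'=0$ with probability $p=\min(\rho N/\log M,1)$ and
$M'=M-1$ otherwise. A clean download costs $L$ symbols and Sun–Jafar on all files costs
$L(1+1/N+\dots+1/N^{M-1})$, so the expected download is affine in $p$ (`WSJ.rate_eq`); the cost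
comes from counting words of servers (`SJSlot.card_eq`).

For the leakage, a server sees a clean request, which names the file, with probability $p/N$.
Everything else it sees has a law that does not depend on the desired file: the null query
trivially, the Sun–Jafar query by `sjQueryLaw_map_apply`. Hence it learns exactly $(p/N)\log M$ bits
(`mutualInfo_of_disclosure`). Privacy holds because the sums at one server use distinct segments of
each file, so the way the segments are assigned to these sums is a permutation, which the uniformly
random order absorbs.

For correctness, a sum that involves the desired file consists of one of its segments and a sum
downloaded elsewhere, which is subtracted (`sj_decode`). With two or more servers the queries even
reveal the index jointly, since only the desired file has no reused segment
(`sjQuery_index_unique`). -/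

theorem SJSlot.ext {x y : SJSlot N ι} (hf : x.files = y.files) (hw : x.word = y.word) :
    x = y := by
  cases x
  cases y
  cases hf
  cases hw
  rfl

theorem SJSlot.exists_word_eq_cons (x : SJSlot N ι) : ∃ l w, x.word = l :: w := by
  obtain ⟨V, _ | ⟨l, w⟩, h, h', c⟩ := x
  · exact absurd h' (by simpa using h.card_pos.ne)
  · exact ⟨l, w, rfl⟩

section Label

variable [DecidableEq ι]

theorem SJSlot.label_of_notMem {k : ι} {x : SJSlot N ι} (hk : k ∉ x.files) {j : ι}
    (hj : j ∈ x.files) : x.label k j hj = ⟨x, hj⟩ :=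
  dif_neg fun h => hk h.1

theorem SJSlot.label_self {k : ι} {x : SJSlot N ι} (hk : k ∈ x.files) :
    x.label k k hk = ⟨x, hk⟩ :=
  dif_neg fun h => h.2 rfl

theorem SJSlot.files_label {k j : ι} {x : SJSlot N ι} (hk : k ∈ x.files) (hj : j ∈ x.files)
    (hjk : j ≠ k) : (x.label k j hj).1.files = x.files.erase k := by
  rw [SJSlot.label, dif_pos ⟨hk, hjk⟩]

theorem SJSlot.word_label {k j : ι} {x : SJSlot N ι} (hk : k ∈ x.files) (hj : j ∈ x.files)
    (hjk : j ≠ k) : (x.label k j hj).1.word = x.word.tail := by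
  rw [SJSlot.label, dif_pos ⟨hk, hjk⟩]

/-- The sums that are asked from one server contain distinct segments of file `j`. -/
theorem SJSlot.label_injOn_server {k j : ι} {l : Fin N} {x y : SJSlot N ι}
    (hx : x.word.head? = some l) (hy : y.word.head? = some l) (hjx : j ∈ x.files)
    (hjy : j ∈ y.files) (h : x.label k j hjx = y.label k j hjy) : x = y := by
  -- Side information comes from another server: the second letter of the word differs from the
  -- first. So at server `l` it never meets a segment that is new there.
  have hne : ∀ {z : SJSlot N ι} (hjz : j ∈ z.files), z.word.head? = some l → k ∈ z.files →
      j ≠ k → (z.label k j hjz).1.word.head? ≠ some l := by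
    intro z hjz hz hkz hjk
    rw [SJSlot.word_label hkz hjz hjk]
    obtain ⟨a, w, hw⟩ := z.exists_word_eq_cons
    have hc := z.chain
    rw [hw] at hz hc ⊢
    rcases w with _ | ⟨b, w⟩
    · simp
    · have hab : a ≠ b := (List.isChain_cons_cons.1 hc).1
      simp only [List.head?_cons, Option.some.injEq, List.tail_cons, ne_eq] at hz ⊢
      exact fun hb => hab (hz.trans hb.symm)
  by_cases hjk : j = k
  · subst hjk
    rw [SJSlot.label_self, SJSlot.label_self] at h
    exact congrArg Subtype.val h
  by_cases hkx : k ∈ x.files <;> by_cases hky : k ∈ y.files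
  · have hf := congrArg (fun z => z.1.files) h
    have hw := congrArg (fun z => z.1.word) h
    simp only [SJSlot.files_label hkx hjx hjk, SJSlot.files_label hky hjy hjk] at hf
    simp only [SJSlot.word_label hkx hjx hjk, SJSlot.word_label hky hjy hjk] at hw
    refine SJSlot.ext ?_ ?_
    · rw [← Finset.insert_erase hkx, ← Finset.insert_erase hky, hf]
    · rw [← List.cons_head?_tail hx, ← List.cons_head?_tail hy, hw]
  · refine absurd hy ?_
    have := hne hjx hx hkx hjk
    rwa [h, SJSlot.label_of_notMem hky] at this
  · refine absurd hx ?_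
    have := hne hjy hy hky hjk
    rwa [← h, SJSlot.label_of_notMem hkx] at this
  · rw [SJSlot.label_of_notMem hkx, SJSlot.label_of_notMem hky] at h
    exact congrArg Subtype.val h

end Label

/-! ### The number of sums -/

/-- In the induction, the sets containing the added element contribute the binomial sum
$(x+1)^{|U|}$. By truncated subtraction the empty set contributes $x^0=1$, the leading summand. -/
theorem sum_powerset_pow_card_sub_one {α : Type*} [DecidableEq α] (x : ℕ) (U : Finset α) :
    ∑ V ∈ U.powerset, x ^ (V.card - 1) = 1 + ∑ i ∈ range U.card, (x + 1) ^ i := by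
  induction U using Finset.induction_on with
  | empty => simp
  | insert a U ha ih =>
    rw [sum_powerset_insert ha, ih, card_insert_of_notMem ha, sum_range_succ, add_assoc]
    congr 2
    have h := Finset.sum_pow_mul_eq_add_pow x 1 U
    simp only [one_pow, mul_one] at h
    rw [← h]
    refine sum_congr rfl fun V hV => ?_
    rw [card_insert_of_notMem fun h => ha (mem_powerset.1 hV h), Nat.add_sub_cancel]

/-- A slot is a nonempty set of $b$ files, a first letter ($N$ choices) and a continuation
($(N-1)^{b-1}$ choices). -/
theorem SJSlot.card_eq (N : ℕ) [NeZero N] (ι : Type) [Fintype ι] :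
    Nat.card (SJSlot N ι) = ∑ i ∈ range (Fintype.card ι), N ^ (i + 1) := by
  classical
  have e : SJSlot N ι ≃ ((y : {V : Finset ι // V.Nonempty} × Fin N) ×
      {w : List (Fin N) // w.length = y.1.1.card - 1 ∧ (y.2 :: w).IsChain (· ≠ ·)}) :=
    { toFun := fun x => match x with
        | ⟨V, [], h, h', _⟩ => absurd h' (by simpa using h.card_pos.ne)
        | ⟨V, l :: w, h, h', c⟩ => ⟨(⟨V, h⟩, l), ⟨w, by simp [← h'], c⟩⟩
      invFun := fun x => ⟨x.1.1.1, x.1.2 :: x.2.1, x.1.1.2, by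
        rw [List.length_cons, x.2.2.1]
        exact Nat.sub_add_cancel (Finset.card_pos.2 x.1.1.2), x.2.2.2⟩
      left_inv := by
        rintro ⟨V, _ | ⟨l, w⟩, h, h', c⟩
        · exact absurd h' (by simpa using h.card_pos.ne)
        · rfl
      right_inv := fun x => rfl }
  have hfin : ∀ y : {V : Finset ι // V.Nonempty} × Fin N,
      Finite {w : List (Fin N) // w.length = y.1.1.card - 1 ∧ (y.2 :: w).IsChain (· ≠ ·)} :=
    fun y => ((List.finite_length_eq (Fin N) _).subset (fun w h => h.1)).to_subtype
  rw [Nat.card_congr e, Nat.card_sigma]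
  simp only [SJLabel.card_words]
  rw [Fintype.sum_prod_type]
  simp only [sum_const, card_univ, Fintype.card_fin, smul_eq_mul]
  rw [← mul_sum]
  have h1 : ∑ V : Finset ι, (N - 1) ^ (V.card - 1) =
      1 + ∑ V : {V : Finset ι // V.Nonempty}, (N - 1) ^ (V.1.card - 1) := by
    rw [← Fintype.sum_subtype_add_sum_subtype (fun V : Finset ι => V.Nonempty), add_comm]
    congr 1
    rw [Fintype.sum_eq_single (⟨∅, by simp⟩ : {V : Finset ι // ¬ V.Nonempty})]
    · simp
    · rintro ⟨V, hV⟩ h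
      exact absurd (Subtype.ext (Finset.not_nonempty_iff_eq_empty.1 hV)) h
  have h2 := sum_powerset_pow_card_sub_one (N - 1) (univ : Finset ι)
  rw [powerset_univ, h1, Nat.sub_add_cancel (Nat.one_le_iff_ne_zero.2 (NeZero.ne N))] at h2
  rw [Nat.add_left_cancel h2, card_univ, mul_sum]
  exact sum_congr rfl fun i _ => (pow_succ' N i).symm

variable [Fintype ι] [DecidableEq ι]

theorem sjSum_image_fst (k : ι) (σ : (j : ι) → SJLabel N j ≃ Fin (N ^ Fintype.card ι))
    (x : SJSlot N ι) : (sjSum k σ x).image Prod.fst = x.files := by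
  rw [sjSum, image_image]
  exact attach_image_val

theorem mem_sjSum {k : ι} {σ : (j : ι) → SJLabel N j ≃ Fin (N ^ Fintype.card ι)}
    {x : SJSlot N ι} {j : ι} {a : Fin (N ^ Fintype.card ι)} :
    (j, a) ∈ sjSum k σ x ↔ ∃ hj : j ∈ x.files, σ j (x.label k j hj) = a := by
  simp only [sjSum, mem_image, mem_attach, true_and, Subtype.exists, Prod.mk.injEq]
  constructor
  · rintro ⟨i, hi, rfl, h⟩
    exact ⟨hi, h⟩
  · rintro ⟨hj, h⟩
    exact ⟨j, hj, rfl, h⟩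

/-- Every sum contains a segment labelled by its own slot: that of file `k` if `k` is involved, and
that of any file otherwise. As the order is a bijection, this segment identifies the slot. -/
theorem sjSum_injective (k : ι) (σ : (j : ι) → SJLabel N j ≃ Fin (N ^ Fintype.card ι)) :
    Function.Injective (sjSum k σ) := by
  intro x y h
  have hf : x.files = y.files := by
    rw [← sjSum_image_fst k σ x, h, sjSum_image_fst]
  obtain ⟨j, hj, hjk⟩ : ∃ j ∈ x.files, k ∉ x.files ∨ j = k := by
    by_cases hk : k ∈ x.files
    · exact ⟨k, hk, Or.inr rfl⟩
    · obtain ⟨j, hj⟩ := x.nonempty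
      exact ⟨j, hj, Or.inl hk⟩
  have hlab : ∀ (z : SJSlot N ι) (hz : j ∈ z.files), z.files = x.files →
      z.label k j hz = ⟨z, hz⟩ := by
    intro z hz hzx
    rcases hjk with hk | rfl
    · exact SJSlot.label_of_notMem (hzx ▸ hk) hz
    · exact SJSlot.label_self hz
  have hmem : (j, σ j (x.label k j hj)) ∈ sjSum k σ y := h ▸ mem_sjSum.2 ⟨hj, rfl⟩
  obtain ⟨hj', h'⟩ := mem_sjSum.1 hmem
  rw [hlab x hj rfl, hlab y hj' hf.symm] at h'
  exact (congrArg Subtype.val ((σ j).injective h')).symm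

theorem mem_sjQuery {k : ι} {σ : (j : ι) → SJLabel N j ≃ Fin (N ^ Fintype.card ι)} {l : Fin N}
    {y : Finset (ι × Fin (N ^ Fintype.card ι))} :
    y ∈ sjQuery k σ l ↔ ∃ x : SJSlot N ι, x.word.head? = some l ∧ sjSum k σ x = y := by
  simp [sjQuery]

theorem sum_card_sjQuery [NeZero N] (k : ι)
    (σ : (j : ι) → SJLabel N j ≃ Fin (N ^ Fintype.card ι)) :
    ∑ l, (sjQuery k σ l).card = ∑ i ∈ range (Fintype.card ι), N ^ (i + 1) := by
  have hcard : (univ : Finset (SJSlot N ι)).card = ∑ i ∈ range (Fintype.card ι), N ^ (i + 1) := by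
    rw [← SJSlot.card_eq N ι, Nat.card_eq_fintype_card, card_univ]
  refine Eq.trans ?_ hcard
  rw [card_eq_sum_card_fiberwise (s := (univ : Finset (SJSlot N ι)))
    (f := fun x : SJSlot N ι => x.word.head?) (t := univ.image some)]
  · rw [sum_image fun _ _ _ _ h => Option.some.inj h]
    exact sum_congr rfl fun l _ => card_image_of_injective _ (sjSum_injective k σ)
  · intro x _
    obtain ⟨l, w, h⟩ := x.exists_word_eq_cons
    simp [h]

/-! ### Privacy -/

/-- The law of the query to server `l` when the segments of each file are used in a random order and
each sum consists of its own segments; it does not depend on any desired file. -/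
def sjServerLaw (N : ℕ) [NeZero N] (ι : Type) [Fintype ι] [DecidableEq ι] (l : Fin N) :
    PMF (SJQuery N ι) :=
  (PMF.uniformOfFintype ((j : ι) → SJLabel N j ≃ Fin (N ^ Fintype.card ι))).map fun τ =>
    (univ.filter fun x : SJSlot N ι => x.word.head? = some l).image fun x =>
      x.files.attach.image fun j => (j.1, τ j.1 ⟨x, j.2⟩)

theorem PMF.map_uniformOfFintype_equiv {α : Type*} [Fintype α] [Nonempty α] (e : α ≃ α) :
    (PMF.uniformOfFintype α).map e = PMF.uniformOfFintype α := by
  classical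
  ext a
  rw [PMF.map_apply, tsum_eq_single (e.symm a)]
  · simp
  · intro b hb
    rw [if_neg]
    rintro rfl
    simp at hb

/-- On the slots of one server the assignment of segments is injective, and an injection from a
subset of a finite set to that set extends to a permutation. -/
theorem exists_perm_label (k : ι) (l : Fin N) (j : ι) :
    ∃ e : SJLabel N j ≃ SJLabel N j, ∀ (x : SJSlot N ι) (hj : j ∈ x.files),
      x.word.head? = some l → e ⟨x, hj⟩ = x.label k j hj := by
  classical
  let f : {x : SJLabel N j // x.1.word.head? = some l} → SJLabel N j :=
    fun x => x.1.1.label k j x.1.2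
  have hf : Function.Injective f := fun x y h =>
    Subtype.ext (Subtype.ext (SJSlot.label_injOn_server x.2 y.2 x.1.2 y.1.2 h))
  let e := Equiv.ofInjective f hf
  refine ⟨Equiv.extendSubtype (q := fun y => y ∈ Set.range f) e, fun x hj hx => ?_⟩
  rw [Equiv.extendSubtype_apply_of_mem e ⟨x, hj⟩ hx]
  rfl

/-- This is the privacy of the Sun–Jafar queries: the right side does not mention `k`. Composing the
order of each file with the permutation from `exists_perm_label` preserves the uniform law and turns
one description of the query into the other. -/
theorem sjQueryLaw_map_apply [NeZero N] (k : ι) (l : Fin N) :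
    (sjQueryLaw N k).map (fun q => q l) = sjServerLaw N ι l := by
  choose e he using exists_perm_label (N := N) k l
  let E : ((j : ι) → SJLabel N j ≃ Fin (N ^ Fintype.card ι)) ≃
      ((j : ι) → SJLabel N j ≃ Fin (N ^ Fintype.card ι)) :=
    Equiv.piCongrRight fun j => Equiv.equivCongr (e j).symm (Equiv.refl _)
  rw [sjServerLaw, ← PMF.map_uniformOfFintype_equiv E, sjQueryLaw, PMF.map_comp, PMF.map_comp]
  congr 1
  funext σ
  refine image_congr fun x hx => ?_
  have hx' : x.word.head? = some l := by simpa using hx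
  refine image_congr fun j _ => ?_
  rw [← he j.1 x j.2 hx']
  rfl

/-! ### Correctness -/

/-- The segments of file `k` can be computed from the answers. -/
theorem sj_decode {B : Type*} [AddCommGroup B] (k : ι)
    (σ : (j : ι) → SJLabel N j ≃ Fin (N ^ Fintype.card ι))
    (W W' : ι → Fin (N ^ Fintype.card ι) → B)
    (h : ∀ l, ∀ y ∈ sjQuery k σ l, ∑ p ∈ y, W p.1 p.2 = ∑ p ∈ y, W' p.1 p.2) :
    W k = W' k := by
  funext a
  obtain ⟨⟨x, hk⟩, rfl⟩ := (σ k).surjective a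
  have hall : ∀ z : SJSlot N ι, ∑ p ∈ sjSum k σ z, W p.1 p.2 = ∑ p ∈ sjSum k σ z, W' p.1 p.2 := by
    intro z
    obtain ⟨l, w, hw⟩ := z.exists_word_eq_cons
    exact h l _ (mem_sjQuery.2 ⟨z, by simp [hw], rfl⟩)
  have hsum : ∀ (U : ι → Fin (N ^ Fintype.card ι) → B) (z : SJSlot N ι),
      ∑ p ∈ sjSum k σ z, U p.1 p.2 = ∑ j ∈ z.files.attach, U j.1 (σ j.1 (z.label k j.1 j.2)) := by
    intro U z
    rw [sjSum, sum_image]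
    intro i _ j _ hij
    exact Subtype.ext (congrArg Prod.fst hij)
  by_cases hne : (x.files.erase k).Nonempty
  · obtain ⟨j₀, hj₀⟩ := hne
    have hj₀' := mem_erase.1 hj₀
    -- The slot of the side information; it does not depend on the choice of `j₀`.
    let z : SJSlot N ι := (x.label k j₀ hj₀'.2).1
    have hz : z.files = x.files.erase k := SJSlot.files_label hk hj₀'.2 hj₀'.1
    have hzw : z.word = x.word.tail := SJSlot.word_label hk hj₀'.2 hj₀'.1
    -- The structural core of decoding: the sum `x` is the sum `z` with one segment of file `k`
    -- added.
    have hsub : sjSum k σ x = insert (k, σ k ⟨x, hk⟩) (sjSum k σ z) := by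
      ext ⟨j, b⟩
      rw [mem_insert, mem_sjSum, mem_sjSum]
      by_cases hjk : j = k
      · subst hjk
        simp only [Prod.mk.injEq, true_and]
        have : j ∉ z.files := by simp [hz]
        simp only [this, IsEmpty.exists_iff, or_false, SJSlot.label_self, hk, exists_true_left]
        exact eq_comm
      · have hkz : k ∉ z.files := by simp [hz]
        simp only [Prod.mk.injEq, hjk, false_and, false_or]
        constructor
        · rintro ⟨hj, rfl⟩
          have hjz : j ∈ z.files := hz ▸ mem_erase.2 ⟨hjk, hj⟩
          refine ⟨hjz, ?_⟩
          rw [SJSlot.label_of_notMem hkz]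
          congr 1
          refine Subtype.ext (SJSlot.ext ?_ ?_)
          · rw [SJSlot.files_label hk hj hjk, hz]
          · rw [SJSlot.word_label hk hj hjk, hzw]
        · rintro ⟨hjz, rfl⟩
          have hj : j ∈ x.files := (mem_erase.1 (hz ▸ hjz)).2
          refine ⟨hj, ?_⟩
          rw [SJSlot.label_of_notMem hkz]
          congr 1
          refine Subtype.ext (SJSlot.ext ?_ ?_)
          · rw [SJSlot.files_label hk hj hjk, hz]
          · rw [SJSlot.word_label hk hj hjk, hzw]
    have hnot : (k, σ k ⟨x, hk⟩) ∉ sjSum k σ z := by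
      rw [mem_sjSum]
      rintro ⟨hkz, _⟩
      rw [hz] at hkz
      exact notMem_erase _ _ hkz
    have hx := hall x
    rw [hsub, sum_insert hnot, sum_insert hnot, hall z] at hx
    exact add_right_cancel hx
  · have hx : x.files = {k} := by
      rw [← insert_erase hk, not_nonempty_iff_eq_empty.1 hne]
      rfl
    have hs : sjSum k σ x = {(k, σ k ⟨x, hk⟩)} := by
      ext ⟨j, b⟩
      rw [mem_singleton, mem_sjSum]
      constructor
      · rintro ⟨hj, rfl⟩
        obtain rfl : j = k := by simpa [hx] using hj
        rw [SJSlot.label_self]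
      · intro hjb
        obtain ⟨rfl, rfl⟩ := Prod.mk.inj hjb
        exact ⟨hk, by rw [SJSlot.label_self]⟩
    have := hall x
    simpa only [hs, sum_singleton] using this

/-- With at least two servers, the queries determine the desired file: it is the one whose segments
occur in one sum only. -/
theorem sjQuery_index_unique (hN : 2 ≤ N) {k k' : ι}
    {σ σ' : (j : ι) → SJLabel N j ≃ Fin (N ^ Fintype.card ι)}
    (h : sjQuery k σ = sjQuery k' σ') : k = k' := by
  by_contra hne
  have : Nontrivial (Fin N) := Fin.nontrivial_iff_two_le.2 hN
  obtain ⟨l, l', hl⟩ := exists_pair_ne (Fin N)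
  -- If `k` is desired, the segment of `k'` in `x` is reused as side information in `y`, at a
  -- different server.
  let x : SJSlot N ι := ⟨{k'}, [l], by simp, by simp, by simp⟩
  let y : SJSlot N ι := ⟨{k, k'}, [l', l], by simp, by simp [hne], by simp [hl.symm]⟩
  have hslot : ∀ z : SJSlot N ι, ∃ z' : SJSlot N ι, sjSum k' σ' z' = sjSum k σ z := by
    intro z
    obtain ⟨m, w, hw⟩ := z.exists_word_eq_cons
    have hz : sjSum k σ z ∈ sjQuery k σ m := mem_sjQuery.2 ⟨z, by simp [hw], rfl⟩
    rw [h] at hz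
    obtain ⟨z', _, hz'⟩ := mem_sjQuery.1 hz
    exact ⟨z', hz'⟩
  obtain ⟨x', hx'⟩ := hslot x
  obtain ⟨y', hy'⟩ := hslot y
  have hkx : k' ∈ x.files := by simp [x]
  have hky : k' ∈ y.files := by simp [y]
  have hlab : y.label k k' hky = x.label k k' hkx := by
    rw [SJSlot.label_of_notMem (x := x) (by simpa [x] using hne)]
    refine Subtype.ext (SJSlot.ext ?_ ?_)
    · rw [SJSlot.files_label (by simp [y]) hky (Ne.symm hne)]
      simp [x, y, hne]
    · rw [SJSlot.word_label (by simp [y]) hky (Ne.symm hne)]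
      simp [x, y]
  have hmx : (k', σ k' (x.label k k' hkx)) ∈ sjSum k' σ' x' := hx' ▸ mem_sjSum.2 ⟨hkx, rfl⟩
  have hmy : (k', σ k' (x.label k k' hkx)) ∈ sjSum k' σ' y' :=
    hy' ▸ mem_sjSum.2 ⟨hky, by rw [hlab]⟩
  obtain ⟨h1, h1'⟩ := mem_sjSum.1 hmx
  obtain ⟨h2, h2'⟩ := mem_sjSum.1 hmy
  rw [SJSlot.label_self] at h1' h2'
  -- If `k'` is desired, each of its segments lies in one sum only. So `x` and `y` would be the same
  -- sum, but only `y` involves `k`.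
  have hxy : x' = y' := congrArg Subtype.val ((σ' k').injective (h1'.trans h2'.symm))
  rw [← hxy, hx'] at hy'
  have hf := congrArg SJSlot.files (sjSum_injective k σ hy')
  have hk : k ∈ y.files := by simp [y]
  rw [← hf] at hk
  exact hne (by simpa [x] using hk)

end SunJafarCombinatorics

/-! ## Finitely valued random variables -/

section Information

variable {α β : Type*}

theorem PMF.map_apply_eq_of_unique (p : PMF α) (f : α → β) (a : α)
    (h : ∀ a' ∈ p.support, f a' = f a → a' = a) : p.map f (f a) = p a := by
  classical
  rw [PMF.map_apply, tsum_eq_single a]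
  · simp
  · intro a' ha'
    split_ifs with hf
    · by_contra h0
      exact ha' (h a' ((PMF.mem_support_iff _ _).2 h0) hf.symm)
    · rfl

/-- On the support the second coordinate determines the pair, so the joint and marginal
probabilities agree and each logarithm is $\log 1$. -/
theorem condEntropy_eq_zero_of_determined (p : PMF (α × β))
    (h : ∀ x ∈ p.support, ∀ y ∈ p.support, x.2 = y.2 → x.1 = y.1) : condEntropy p = 0 := by
  have hterm : ∀ x : α × β, (p x).toReal *
      Real.logb 2 ((p x).toReal / (p.map Prod.snd x.2).toReal) = 0 := by
    intro x
    by_cases hx : p x = 0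
    · simp [hx]
    · have hxs := (PMF.mem_support_iff p x).2 hx
      rw [PMF.map_apply_eq_of_unique p Prod.snd x
        fun y hy hyx => Prod.ext (h y hy x hxs hyx) hyx, div_self, Real.logb_one, mul_zero]
      exact ENNReal.toReal_ne_zero.2 ⟨hx, PMF.apply_ne_top p x⟩
  simp only [condEntropy, hterm, tsum_zero, neg_zero]

/-- The law of total expectation for an `f` that is constant given `a`. It applies to the download
cost, which depends only on $M'$. -/
theorem PMF.tsum_toReal_mul_bind_of_support [Fintype α] [Finite β] (p : PMF α) (g : α → PMF β)
    (f : β → ℝ) (c : α → ℝ) (h : ∀ a ∈ p.support, ∀ b ∈ (g a).support, f b = c a) :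
    ∑' b, ((p.bind g) b).toReal * f b = ∑ a, (p a).toReal * c a := by
  have := Fintype.ofFinite β
  have hbind : ∀ b, ((p.bind g) b).toReal = ∑ a, (p a).toReal * (g a b).toReal := by
    intro b
    rw [PMF.bind_apply, tsum_fintype, ENNReal.toReal_sum fun a _ =>
      ENNReal.mul_ne_top (PMF.apply_ne_top _ _) (PMF.apply_ne_top _ _)]
    simp only [ENNReal.toReal_mul]
  have hone : ∀ a, ∑ b, (g a b).toReal = 1 := by
    intro a
    rw [← ENNReal.toReal_sum fun b _ => PMF.apply_ne_top _ _, ← tsum_fintype (L := .unconditional β),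
      PMF.tsum_coe, ENNReal.toReal_one]
  simp only [tsum_fintype, hbind, sum_mul]
  rw [sum_comm]
  refine sum_congr rfl fun a _ => ?_
  by_cases ha : p a = 0
  · simp [ha]
  rw [← one_mul (c a), ← hone a, sum_mul, mul_sum]
  refine sum_congr rfl fun b _ => ?_
  by_cases hb : g a b = 0
  · simp [hb]
  rw [h a ((PMF.mem_support_iff _ _).2 ha) b ((PMF.mem_support_iff _ _).2 hb), mul_assoc]

theorem PMF.uniformOfFinset_eq_pure {s : Finset α} (hs : s.Nonempty) {a : α} (h : s = {a}) :
    PMF.uniformOfFinset s hs = PMF.pure a := by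
  subst h
  ext b
  classical
  simp [PMF.pure_apply]

variable {M : ℕ} [NeZero M]

theorem mutualInfo_uniform_bind (μ : Fin M → PMF β) :
    mutualInfo ((PMF.uniformOfFintype (Fin M)).bind fun k => (μ k).map fun b => (k, b)) =
      ∑' x : Fin M × β, (1 / (M : ℝ)) * (μ x.1 x.2).toReal *
        Real.logb 2 ((μ x.1 x.2).toReal / ((1 / (M : ℝ)) * ∑ k, (μ k x.2).toReal)) := by
  classical
  have hjoint : ∀ x : Fin M × β, ((PMF.uniformOfFintype (Fin M)).bind fun k =>
      (μ k).map fun b => (k, b)) x = (M : ENNReal)⁻¹ * μ x.1 x.2 := by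
    rintro ⟨k, b⟩
    rw [PMF.bind_apply, tsum_eq_single k]
    · rw [PMF.map_apply_eq_of_unique (μ k) (fun b => (k, b)) b fun b' _ h => (Prod.mk.inj h).2]
      simp
    · intro k' hk'
      rw [PMF.map_apply]
      simp [hk'.symm]
  have hfst : ((PMF.uniformOfFintype (Fin M)).bind fun k =>
      (μ k).map fun b => (k, b)).map Prod.fst = PMF.uniformOfFintype (Fin M) := by
    simp only [PMF.map_bind, PMF.map_comp]
    have : ∀ k : Fin M, (μ k).map (Prod.fst ∘ fun b => (k, b)) = PMF.pure k :=
      fun k => PMF.map_const _ _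
    simp only [this, PMF.bind_pure]
  have hsnd : ((PMF.uniformOfFintype (Fin M)).bind fun k =>
      (μ k).map fun b => (k, b)).map Prod.snd = (PMF.uniformOfFintype (Fin M)).bind μ := by
    simp only [PMF.map_bind, PMF.map_comp]
    have : ∀ k : Fin M, (μ k).map (Prod.snd ∘ fun b => (k, b)) = μ k :=
      fun k => PMF.map_id _
    simp only [this]
  have hM : (M : ℝ) ≠ 0 := Nat.cast_ne_zero.2 (NeZero.ne M)
  rw [mutualInfo]
  refine tsum_congr fun x => ?_
  rw [hfst, hsnd, hjoint, PMF.bind_apply, tsum_fintype, ENNReal.toReal_sum fun a _ =>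
      ENNReal.mul_ne_top (PMF.apply_ne_top _ _) (PMF.apply_ne_top _ _)]
  simp only [PMF.uniformOfFintype_apply, Fintype.card_fin, ENNReal.toReal_mul,
    ENNReal.toReal_inv, ENNReal.toReal_natCast, ← mul_sum]
  rw [mul_div_mul_left _ _ (inv_ne_zero hM), one_div]

/-- If the index is uniform, and the law of an observation depends on the index only in that, with
probability `t`, the index itself is observed, then `t * log M` bits are leaked. -/
theorem mutualInfo_of_disclosure (μ : Fin M → PMF β) (c : Fin M → β) (t : ℝ)
    (hcc : ∀ k j, (μ k (c j)).toReal = if k = j then t else 0)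
    (hne : ∀ b ∉ Set.range c, ∀ k j, μ k b = μ j b) :
    mutualInfo ((PMF.uniformOfFintype (Fin M)).bind fun k => (μ k).map fun b => (k, b)) =
      t * Real.logb 2 M := by
  have hM : (M : ℝ) ≠ 0 := Nat.cast_ne_zero.2 (NeZero.ne M)
  rw [mutualInfo_uniform_bind]
  have hinj : Function.Injective fun k : Fin M => (k, c k) := fun k j h => (Prod.mk.inj h).1
  -- Only the pairs `(k, c k)` contribute, each with likelihood ratio $t/(t/M)=M$. A pair `(k, c j)`
  -- with `j ≠ k` has probability zero, and at all other observations the ratio is 1.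
  rw [← hinj.tsum_eq]
  · have hterm : ∀ k : Fin M, (1 / (M : ℝ)) * (μ k (c k)).toReal *
        Real.logb 2 ((μ k (c k)).toReal / ((1 / (M : ℝ)) * ∑ j, (μ j (c k)).toReal)) =
        (1 / (M : ℝ)) * (t * Real.logb 2 M) := by
      intro k
      simp only [hcc, if_true, sum_ite_eq', mem_univ]
      by_cases ht : t = 0
      · simp [ht]
      · rw [mul_assoc]
        congr 3
        field_simp
    rw [tsum_fintype, sum_congr rfl fun k _ => hterm k, sum_const, card_univ, Fintype.card_fin,
      nsmul_eq_mul]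
    field_simp
  · rintro ⟨k, b⟩ hb
    by_contra hrange
    refine hb ?_
    by_cases hbc : b ∈ Set.range c
    · obtain ⟨j, rfl⟩ := hbc
      have hkj : k ≠ j := by
        rintro rfl
        exact hrange ⟨k, rfl⟩
      simp [hcc, hkj]
    · have hsum : ∑ j, (μ j b).toReal = M * (μ k b).toReal := by
        rw [sum_congr rfl fun j _ => congrArg ENNReal.toReal (hne b hbc j k), sum_const,
          card_univ, Fintype.card_fin, nsmul_eq_mul]
      simp only [hsum]
      rw [← mul_assoc, one_div, inv_mul_cancel₀ hM, one_mul]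
      by_cases h0 : (μ k b).toReal = 0
      · simp [h0]
      · rw [div_self h0, Real.logb_one, mul_zero]

end Information

/-! ## The weakly private scheme -/

namespace WSJ

variable {M N : ℕ}

instance instFiniteQuery : Finite (WSJQuery M N) := finite_query M N

theorem exists_symbolIndex (T : Finset (Fin M)) (i : Fin (N ^ M)) :
    ∃ a r, symbolIndex (N := N) T a r = i := by
  have h : N ^ Fintype.card T * N ^ (M - Fintype.card T) = N ^ M := by
    rw [← pow_add, Nat.add_sub_cancel']
    simpa using Finset.card_le_univ T
  obtain ⟨⟨a, r⟩, har⟩ := (finProdFinEquiv (m := N ^ Fintype.card T)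
    (n := N ^ (M - Fintype.card T))).surjective (Fin.cast h.symm i)
  exact ⟨a, r, by rw [symbolIndex, har]; rfl⟩

theorem queries_and_answers_eq {A : Type*} [AddCommGroup A]
    {Q Q' : Fin N → WSJQuery M N} {W W' : Fin M → Fin (N ^ M) → A}
    (h : (fun l => (⟨Q l, answer (Q l) W⟩ : (q : WSJQuery M N) × (AnswerPos q → A))) =
      fun l => ⟨Q' l, answer (Q' l) W'⟩) :
    Q = Q' ∧ ∀ l, answer (Q l) W = answer (Q l) W' := by
  obtain rfl : Q = Q' := funext fun l => congrArg Sigma.fst (congrFun h l)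
  exact ⟨rfl, fun l => eq_of_heq (Sigma.mk.inj (congrFun h l)).2⟩

variable [NeZero N]

/-- The law of the queries for file `k`, given the number of additional files. -/
def condQueryLaw (N : ℕ) [NeZero N] (k m : Fin M) : PMF (Fin N → WSJQuery M N) :=
  if m.1 = 0 then
    (PMF.uniformOfFintype (Fin N)).map fun S l => if l = S then .clean k else .null
  else
    (PMF.uniformOfFinset _ (powersetCard_nonempty k m)).bind fun J =>
      (sjQueryLaw (ι := (insert k J : Finset (Fin M))) N ⟨k, Finset.mem_insert_self k J⟩).map
        fun q l => .sj (insert k J) (q l)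

theorem queryLaw_eq_bind (P : PMF (Fin M)) (k : Fin M) :
    queryLaw (N := N) P k = P.bind fun m => condQueryLaw N k m := rfl

theorem mem_support_condQueryLaw {k m : Fin M} {Q : Fin N → WSJQuery M N}
    (hQ : Q ∈ (condQueryLaw N k m).support) :
    (m.1 = 0 ∧ ∃ S, Q = fun l => if l = S then .clean k else .null) ∨
    (m.1 ≠ 0 ∧ ∃ (T : Finset (Fin M)) (hk : k ∈ T)
      (σ : (j : T) → SJLabel N j ≃ Fin (N ^ Fintype.card T)), T.card = m.1 + 1 ∧
        Q = fun l => .sj T (sjQuery ⟨k, hk⟩ σ l)) := by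
  rw [condQueryLaw] at hQ
  split_ifs at hQ with hm
  · obtain ⟨S, _, rfl⟩ := (PMF.mem_support_map_iff _ _ _).1 hQ
    exact Or.inl ⟨hm, S, rfl⟩
  · obtain ⟨J, hJ, hQ⟩ := (PMF.mem_support_bind_iff _ _ _).1 hQ
    obtain ⟨q, hq, rfl⟩ := (PMF.mem_support_map_iff _ _ _).1 hQ
    obtain ⟨σ, _, rfl⟩ := (PMF.mem_support_map_iff _ _ _).1 hq
    rw [PMF.mem_support_uniformOfFinset_iff, mem_powersetCard] at hJ
    refine Or.inr ⟨hm, insert k J, mem_insert_self k J, σ, ?_, rfl⟩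
    rw [card_insert_of_notMem fun h => notMem_erase k _ (hJ.1 h), hJ.2]

/-! ### Correctness -/

section Decoding

variable {A : Type*} [AddCommGroup A]

theorem decode_of_mem_support {k m : Fin M} {Q : Fin N → WSJQuery M N}
    (hQ : Q ∈ (condQueryLaw N k m).support) {W W' : Fin M → Fin (N ^ M) → A}
    (h : ∀ l, answer (Q l) W = answer (Q l) W') : W k = W' k := by
  rcases mem_support_condQueryLaw hQ with ⟨_, S, rfl⟩ | ⟨_, T, hk, σ, _, rfl⟩
  · have hclean : ∀ q : WSJQuery M N, q = .clean k → answer q W = answer q W' → W k = W' k := by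
      rintro _ rfl hq
      exact hq
    exact hclean _ (if_pos rfl) (h S)
  · funext i
    obtain ⟨a, r, rfl⟩ := exists_symbolIndex (N := N) T i
    -- Sums of super-segments are componentwise, so decoding is done separately for each position
    -- `r` inside a super-segment.
    refine congrFun (sj_decode (ι := T) ⟨k, hk⟩ σ (fun j b => W j (symbolIndex T b r))
      (fun j b => W' j (symbolIndex T b r)) fun l y hy => ?_) a
    exact congrFun (h l) (⟨y, hy⟩, r)

/-- A clean request names the file and the kinds of queries cannot be confused, so only two
Sun–Jafar queries on the same set need an argument. -/
theorem index_unique (hN : 2 ≤ N) {k k' m m' : Fin M} {Q : Fin N → WSJQuery M N}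
    (hQ : Q ∈ (condQueryLaw N k m).support) (hQ' : Q ∈ (condQueryLaw N k' m').support) :
    k = k' := by
  rcases mem_support_condQueryLaw hQ with ⟨_, S, rfl⟩ | ⟨_, T, hk, σ, _, rfl⟩ <;>
    rcases mem_support_condQueryLaw hQ' with ⟨_, S', h⟩ | ⟨_, T', hk', σ', _, h⟩
  · have := congrFun h S
    simp only [if_true] at this
    split_ifs at this
    exact WSJQuery.clean.inj this
  · have := congrFun h S
    simp at this
  · have := congrFun h S'
    simp at this
  · obtain rfl : T = T' := (WSJQuery.sj.inj (congrFun h 0)).1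
    have hq : sjQuery (N := N) (⟨k, hk⟩ : T) σ = sjQuery (⟨k', hk'⟩ : T) σ' :=
      funext fun l => eq_of_heq (WSJQuery.sj.inj (congrFun h l)).2
    exact congrArg Subtype.val (sjQuery_index_unique hN hq)

variable [Fintype A]

theorem mem_support_retrievalLaw {P : PMF (Fin M)} {k : Fin M}
    {x : (Fin (N ^ M) → A) × (Fin N → (q : WSJQuery M N) × (AnswerPos q → A))}
    (hx : x ∈ ((wsjScheme (N := N) A P).retrievalLaw k).support) :
    ∃ m, ∃ Q ∈ (condQueryLaw N k m).support, ∃ W : Fin M → Fin (N ^ M) → A,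
      x = (W k, fun l => ⟨Q l, answer (Q l) W⟩) := by
  obtain ⟨Q, hQ, hx⟩ := (PMF.mem_support_bind_iff _ _ _).1 hx
  obtain ⟨W, _, rfl⟩ := (PMF.mem_support_map_iff _ _ _).1 hx
  obtain ⟨m, _, hQ⟩ := (PMF.mem_support_bind_iff _ _ _).1 hQ
  exact ⟨m, Q, hQ, W, rfl⟩

theorem correctForEachIndex (P : PMF (Fin M)) :
    (wsjScheme (N := N) A P).CorrectForEachIndex := by
  refine fun k => condEntropy_eq_zero_of_determined _ fun x hx y hy hxy => ?_
  obtain ⟨m, Q, hQ, W, rfl⟩ := mem_support_retrievalLaw hx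
  obtain ⟨m', Q', hQ', W', rfl⟩ := mem_support_retrievalLaw hy
  obtain ⟨rfl, h⟩ := queries_and_answers_eq hxy
  exact decode_of_mem_support hQ h

theorem correct [NeZero M] (hN : 2 ≤ N) (P : PMF (Fin M)) :
    (wsjScheme (N := N) A P).Correct := by
  refine condEntropy_eq_zero_of_determined _ fun x hx y hy hxy => ?_
  obtain ⟨k, _, hx⟩ := (PMF.mem_support_bind_iff _ _ _).1 hx
  obtain ⟨k', _, hy⟩ := (PMF.mem_support_bind_iff _ _ _).1 hy
  obtain ⟨m, Q, hQ, W, rfl⟩ := mem_support_retrievalLaw hx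
  obtain ⟨m', Q', hQ', W', rfl⟩ := mem_support_retrievalLaw hy
  obtain ⟨rfl, h⟩ := queries_and_answers_eq hxy
  obtain rfl := index_unique hN hQ hQ'
  exact decode_of_mem_support hQ h

end Decoding

/-! ### Leakage -/

/-- With $M-1$ additional files there is only one choice of `J`, so the set of files in the query
reveals nothing; the rest is Sun–Jafar privacy. -/
theorem condQueryLaw_map_of_full {k m : Fin M} (hm0 : m.1 ≠ 0) (hm : m.1 = M - 1) (l : Fin N) :
    (condQueryLaw N k m).map (fun Q => Q l) =
      (sjServerLaw N (univ : Finset (Fin M)) l).map (WSJQuery.sj univ) := by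
  have hT : ∀ (T : Finset (Fin M)) (hk : k ∈ T),
      ((sjQueryLaw N (⟨k, hk⟩ : T)).map fun q l => WSJQuery.sj T (q l)).map (fun Q => Q l) =
        (sjServerLaw N T l).map (WSJQuery.sj T) := by
    intro T hk
    rw [← sjQueryLaw_map_apply ⟨k, hk⟩ l, PMF.map_comp, PMF.map_comp]
    rfl
  have hs : powersetCard m.1 (univ.erase k) = {univ.erase k} := by
    have : m.1 = (univ.erase k).card := by
      rw [card_erase_of_mem (mem_univ k), card_univ, Fintype.card_fin, hm]
    rw [this, powersetCard_self]
  rw [condQueryLaw, if_neg hm0, PMF.uniformOfFinset_eq_pure _ hs, PMF.pure_bind, hT,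
    insert_erase (mem_univ k)]

theorem condQueryLaw_map_zero_clean {k m : Fin M} (hm : m.1 = 0) (l : Fin N) (j : Fin M) :
    (condQueryLaw N k m).map (fun Q => Q l) (.clean j) = if k = j then (N : ENNReal)⁻¹ else 0 := by
  classical
  rw [condQueryLaw, if_pos hm, PMF.map_comp, PMF.map_apply, tsum_eq_single l]
  · simp [eq_comm]
  · intro S hS
    simp [hS.symm]

theorem condQueryLaw_map_zero_of_ne_clean {m : Fin M} (hm : m.1 = 0) (l : Fin N)
    {q : WSJQuery M N} (hq : q ∉ Set.range WSJQuery.clean) (k k' : Fin M) :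
    (condQueryLaw N k m).map (fun Q => Q l) q = (condQueryLaw N k' m).map (fun Q => Q l) q := by
  classical
  rw [condQueryLaw, condQueryLaw, if_pos hm, if_pos hm, PMF.map_comp, PMF.map_comp,
    PMF.map_apply, PMF.map_apply]
  refine tsum_congr fun S => ?_
  by_cases hS : l = S
  · have : ∀ j, q ≠ .clean j := fun j h => hq ⟨j, h.symm⟩
    simp [hS, this]
  · simp [hS]

theorem mutualInfoLeakage_eq {A : Type*} [AddCommGroup A] [NeZero M]
    (P : PMF (Fin M)) (hP : ∀ m ∈ P.support, m.1 = 0 ∨ m.1 = M - 1) :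
    (wsjScheme (N := N) A P).mutualInfoLeakage = (P 0).toReal * Real.logb 2 M / N := by
  have hN : (N : ℝ) ≠ 0 := Nat.cast_ne_zero.2 (NeZero.ne N)
  have hl : ∀ l : Fin N, mutualInfo
      ((wsjScheme (N := N) A P).indexQueryLaw.map fun x => (x.1, x.2 l)) =
        (P 0).toReal / N * Real.logb 2 M := by
    intro l
    have hlaw : (wsjScheme (N := N) A P).indexQueryLaw.map (fun x => (x.1, x.2 l)) =
        (PMF.uniformOfFintype (Fin M)).bind fun k =>
          ((queryLaw (N := N) P k).map fun Q => Q l).map fun b => (k, b) := by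
      rw [IRScheme.indexQueryLaw, PMF.map_bind]
      simp only [PMF.map_comp]
      rfl
    rw [hlaw]
    have hμ : ∀ k q, ((queryLaw (N := N) P k).map fun Q => Q l) q =
        ∑ m, P m * (condQueryLaw N k m).map (fun Q => Q l) q := by
      intro k q
      rw [queryLaw_eq_bind, PMF.map_bind, PMF.bind_apply, tsum_fintype]
    -- The disclosing observations are the clean requests, each with probability $\mathsf P(M'=0)/N$
    -- when its file is desired.
    refine mutualInfo_of_disclosure _ WSJQuery.clean _ ?_ ?_
    · intro k j
      rw [hμ, Fintype.sum_eq_single 0]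
      · rw [condQueryLaw_map_zero_clean (by simp)]
        split_ifs <;> simp [div_eq_mul_inv]
      · intro m hm
        have hm0 : m.1 ≠ 0 := fun h => hm (Fin.ext (by simpa using h))
        by_cases hPm : P m = 0
        · rw [hPm, zero_mul]
        have hm1 := (hP m ((PMF.mem_support_iff _ _).2 hPm)).resolve_left hm0
        rw [condQueryLaw_map_of_full hm0 hm1, PMF.map_apply]
        simp
    · intro q hq k j
      rw [hμ, hμ]
      refine sum_congr rfl fun m _ => ?_
      by_cases hPm : P m = 0
      · rw [hPm, zero_mul, zero_mul]
      by_cases hm0 : m.1 = 0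
      · rw [condQueryLaw_map_zero_of_ne_clean hm0 l hq k j]
      · have hm1 := (hP m ((PMF.mem_support_iff _ _).2 hPm)).resolve_left hm0
        rw [condQueryLaw_map_of_full hm0 hm1, condQueryLaw_map_of_full hm0 hm1]
  rw [IRScheme.mutualInfoLeakage, sum_congr rfl fun l _ => hl l, sum_const, card_univ,
    Fintype.card_fin, nsmul_eq_mul]
  field_simp

/-! ### Rate -/

/-- The cost depends only on $M'$. With $s=M'+1$ files, $N+\dots+N^s$ sums of $N^{M-s}$ symbols are
downloaded; for $M'=0$ the same formula gives the $N^M$ symbols of a clean download. -/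
theorem downloadBits_of_mem_support {A : Type*} [AddCommGroup A] [Fintype A] {P : PMF (Fin M)}
    {k m : Fin M} {Q : Fin N → WSJQuery M N} (hQ : Q ∈ (condQueryLaw N k m).support) :
    (wsjScheme (N := N) A P).downloadBits Q =
      (N : ℝ) ^ M * (∑ i ∈ range (m.1 + 1), 1 / (N : ℝ) ^ i) *
        Real.logb 2 (Fintype.card A) := by
  have hN : (N : ℝ) ≠ 0 := Nat.cast_ne_zero.2 (NeZero.ne N)
  change ∑ l, (@Fintype.card (AnswerPos (Q l)) (instFintypeAnswerPos (Q l)) : ℝ) *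
    Real.logb 2 (Fintype.card A) = _
  rw [← sum_mul]
  congr 1
  rcases mem_support_condQueryLaw hQ with ⟨hm, S, rfl⟩ | ⟨_, T, hk, σ, hT, rfl⟩
  · rw [Fintype.sum_eq_single S]
    · have : @Fintype.card (AnswerPos (if S = S then WSJQuery.clean k else (.null : WSJQuery M N)))
          (instFintypeAnswerPos _) = N ^ M := by
        rw [if_pos rfl]
        exact Fintype.card_fin _
      rw [this, hm]
      simp
    · intro l hl
      have : @Fintype.card (AnswerPos (if l = S then WSJQuery.clean k else (.null : WSJQuery M N)))
          (instFintypeAnswerPos _) = 0 := by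
        rw [if_neg hl]
        exact Fintype.card_empty
      rw [this, Nat.cast_zero]
  · have hle : m.1 + 1 ≤ M := m.2
    have hcard : ∀ l, @Fintype.card (AnswerPos (.sj T (sjQuery ⟨k, hk⟩ σ l)))
        (instFintypeAnswerPos _) = (sjQuery ⟨k, hk⟩ σ l).card * N ^ (M - (m.1 + 1)) := by
      intro l
      refine (Fintype.card_prod _ _).trans ?_
      rw [Fintype.card_fin, ← hT, ← Fintype.card_coe T]
      exact congrArg (· * _) (Fintype.card_coe _)
    simp only [hcard]
    -- Read backwards, the sum has $i$-th term $N^{M-i}$.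
    rw [← Nat.cast_sum, ← sum_mul, sum_card_sjQuery, Fintype.card_coe, hT, sum_mul, mul_sum,
      ← sum_range_reflect, Nat.cast_sum]
    refine sum_congr rfl fun i hi => ?_
    have hi' := mem_range.1 hi
    rw [← pow_add, Nat.cast_pow, mul_one_div, eq_div_iff (pow_ne_zero _ hN), ← pow_add]
    congr 1
    omega

theorem rate_eq {A : Type*} [AddCommGroup A] [Fintype A] [Nontrivial A] [NeZero M]
    (P : PMF (Fin M)) :
    (wsjScheme (N := N) A P).rate =
      (∑ m : Fin M, (P m).toReal * ∑ i ∈ range (m.1 + 1), 1 / (N : ℝ) ^ i)⁻¹ := by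
  have hN : (N : ℝ) ≠ 0 := Nat.cast_ne_zero.2 (NeZero.ne N)
  have hA : Real.logb 2 (Fintype.card A) ≠ 0 :=
    (Real.logb_pos one_lt_two (Nat.one_lt_cast.2 Fintype.one_lt_card)).ne'
  have hlaw : (wsjScheme (N := N) A P).indexQueryLaw = P.bind fun m =>
      (PMF.uniformOfFintype (Fin M)).bind fun k => (condQueryLaw N k m).map fun Q => (k, Q) := by
    -- Drawing $M'$ before the index lets the cost be averaged over $M'$ alone.
    rw [PMF.bind_comm, IRScheme.indexQueryLaw]
    congr 1
    funext k
    exact PMF.map_bind _ _ _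
  have hE := PMF.tsum_toReal_mul_bind_of_support P
    (fun m => (PMF.uniformOfFintype (Fin M)).bind fun k =>
      (condQueryLaw N k m).map fun Q => (k, Q))
    (fun x => (wsjScheme (N := N) A P).downloadBits x.2)
    (fun m => (N : ℝ) ^ M * (∑ i ∈ range (m.1 + 1), 1 / (N : ℝ) ^ i) *
        Real.logb 2 (Fintype.card A)) (by
      rintro m _ x hx
      obtain ⟨k, _, hx⟩ := (PMF.mem_support_bind_iff _ _ _).1 hx
      obtain ⟨Q, hQ, rfl⟩ := (PMF.mem_support_map_iff _ _ _).1 hx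
      exact downloadBits_of_mem_support hQ)
  have hL : ((wsjScheme (N := N) A P).L : ℝ) = (N : ℝ) ^ M := Nat.cast_pow N M
  have hsum : ∑ m : Fin M, (P m).toReal * ((N : ℝ) ^ M *
      (∑ i ∈ range (m.1 + 1), 1 / (N : ℝ) ^ i) * Real.logb 2 (Fintype.card A)) =
      ((N : ℝ) ^ M * Real.logb 2 (Fintype.card A)) *
        ∑ m : Fin M, (P m).toReal * ∑ i ∈ range (m.1 + 1), 1 / (N : ℝ) ^ i := by
    rw [mul_sum]
    exact sum_congr rfl fun m _ => by ring
  rw [IRScheme.rate, hlaw, hL]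
  refine (congrArg (fun t => (N : ℝ) ^ M * Real.logb 2 (Fintype.card A) / t) hE).trans ?_
  rw [hsum, div_mul_eq_div_div, div_self (mul_ne_zero (pow_ne_zero _ hN) hA), one_div]

end WSJ

/-! ### The two-point law of $M'$ and the theorem -/

theorem exists_twoPoint_pmf {M : ℕ} [NeZero M] (hM : 2 ≤ M) {p : ℝ} (h0 : 0 ≤ p) (h1 : p ≤ 1) :
    ∃ P : PMF (Fin M), (∀ m ∈ P.support, m.1 = 0 ∨ m.1 = M - 1) ∧ (P 0).toReal = p ∧
      ∀ f : Fin M → ℝ, ∑ m, (P m).toReal * f m =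
        p * f 0 + (1 - p) * f ⟨M - 1, by omega⟩ := by
  have hne : (0 : Fin M) ≠ ⟨M - 1, by omega⟩ := by
    rw [Ne, Fin.ext_iff]
    simp
    omega
  let P : PMF (Fin M) := PMF.ofFintype
    (fun m => ENNReal.ofReal (if m = 0 then p else if m = ⟨M - 1, by omega⟩ then 1 - p else 0)) (by
      rw [← ENNReal.ofReal_sum_of_nonneg]
      · rw [Fintype.sum_eq_add 0 _ hne]
        · simp [hne.symm]
        · rintro m ⟨hm0, hm1⟩
          rw [if_neg hm0, if_neg hm1]
      · intro m _
        split_ifs <;> linarith)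
  have hP : ∀ m, (P m).toReal =
      if m = 0 then p else if m = ⟨M - 1, by omega⟩ then 1 - p else 0 := by
    intro m
    rw [PMF.ofFintype_apply, ENNReal.toReal_ofReal]
    split_ifs <;> linarith
  refine ⟨P, fun m hm => ?_, by rw [hP, if_pos rfl], fun f => ?_⟩
  · by_contra! hcon
    have hm0 : m ≠ 0 := fun h => hcon.1 (by simp [h])
    have hm1 : m ≠ ⟨M - 1, by omega⟩ := fun h => hcon.2 (by rw [h])
    refine (ENNReal.toReal_ne_zero.2 ⟨(PMF.mem_support_iff _ _).1 hm, PMF.apply_ne_top _ _⟩) ?_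
    rw [hP, if_neg hm0, if_neg hm1]
  · rw [Fintype.sum_eq_add 0 _ hne]
    · rw [hP, hP, if_pos rfl, if_neg hne.symm, if_pos rfl]
    · rintro m ⟨hm0, hm1⟩
      rw [hP, if_neg hm0, if_neg hm1, zero_mul]

end

theorem theorem1 {A : Type*} [AddCommGroup A] [Fintype A] [Nontrivial A]
    (M N : ℕ) [NeZero M] [NeZero N] (hM : 2 ≤ M) (ρ : ℝ) (hρ : 0 ≤ ρ) :
    ∃ P : PMF (Fin M),
      (wsjScheme (N := N) A P).CorrectForEachIndex ∧
      (2 ≤ N → (wsjScheme (N := N) A P).Correct) ∧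
      (wsjScheme (N := N) A P).mutualInfoLeakage = min ρ (Real.logb 2 M / N) ∧
      (wsjScheme (N := N) A P).rate =
        (1 + max (1 - ρ * N / Real.logb 2 M) 0 *
          ∑ i ∈ Finset.Icc 1 (M - 1), 1 / (N : ℝ) ^ i)⁻¹ := by
  have hN : (0 : ℝ) < N := Nat.cast_pos.2 (Nat.pos_of_ne_zero (NeZero.ne N))
  have hlog : 0 < Real.logb 2 M := Real.logb_pos one_lt_two (Nat.one_lt_cast.2 hM)
  -- This `p` solves $p\log M/N=\min(\rho,\log M/N)$; the cap at 1 becomes the positive part in the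
  -- rate.
  obtain ⟨P, hP, hP0, hsum⟩ := exists_twoPoint_pmf hM (p := min (ρ * N / Real.logb 2 M) 1)
    (le_min (by positivity) zero_le_one) (min_le_right _ _)
  refine ⟨P, WSJ.correctForEachIndex P, fun h2 => WSJ.correct h2 P, ?_, ?_⟩
  · rw [WSJ.mutualInfoLeakage_eq P hP, hP0, min_mul_of_nonneg _ _ hlog.le,
      div_mul_cancel₀ _ hlog.ne', one_mul, ← min_div_div_right hN.le,
      mul_div_cancel_right₀ _ hN.ne']
  · rw [WSJ.rate_eq, hsum]
    have hmax : max (1 - ρ * N / Real.logb 2 M) 0 = 1 - min (ρ * N / Real.logb 2 M) 1 := by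
      rw [← sub_self (1 : ℝ), max_sub_sub_left]
    have hIcc : ∑ i ∈ Finset.range (M - 1 + 1), 1 / (N : ℝ) ^ i =
        1 + ∑ i ∈ Finset.Icc 1 (M - 1), 1 / (N : ℝ) ^ i := by
      rw [Finset.sum_range_succ', add_comm, Finset.range_eq_Ico,
        Finset.sum_Ico_add' (fun i => 1 / (N : ℝ) ^ i) 0 (M - 1) 1]
      simp only [pow_zero, div_one, zero_add]
      rfl
    rw [hmax]
    congr 1
    simp only [hIcc, Fin.val_zero, zero_add, Finset.sum_range_one, pow_zero, div_one]
    ring
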